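/- Write $[w_1,w_2]$ for the determinant of the vectors $w_1,w_2\in\mathbb{R}^2$ and $e_\theta=(-\sin\theta,\cos\theta)$. An \emph{oval} is a smooth closed strictly convex plane curve of strictly positive curvature, parameterized by tangent direction: $\gamma:\mathbb{R}\to\mathbb{R}^2$ is $C^\infty$, $2\pi$-periodic, and $\gamma'(\theta)$ is a positive multiple of $e_\theta$ for every $\theta$. A \emph{diameter} of a curve is a chord joining two distinct points with parallel tangents; the \emph{area evolute} is the set of midpoints of the diameters, and the \emph{center symmetry set} is the envelope of the lines spanned by the diameters. (1) Let $\gamma$ be an oval and $k>0$. Put $$M(\theta)=\tfrac12\big(\gamma(\theta)+\gamma(\theta+\pi)\big),\qquad u(\theta)=\tfrac k2\big(\gamma(\theta)-\gamma(\theta+\pi)\big),\qquad v=\frac{u'}{[u,u']},$$ let $\alpha=[u,M']/[u,u']$, and put $$\beta(\theta)=\tfrac12\int_\theta^{\theta+\pi}\alpha(s)\,[u,u'](s)\,ds,\qquad N=M+\beta v,\qquad \eta_d=N+d\,v\quad(d\in\mathbb{R}).$$ Then: (a) $M'=\alpha u'$; (b) the involute $N$ is contained in the region bounded by $M$, that is,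 no point of $N$ can be joined to a point of $\gamma$ by a continuous path that avoids $M$; (c) the curves $\eta_d$ have constant $v$-width, $\eta_d(\theta)-\eta_d(\theta+\pi)=2d\,v(\theta)$ for all $d$ and $\theta$; and if $|\beta(\theta)|<d$ for all $\theta$, then the area evolute of $\eta_d$ is (the image of) $N$ and the center symmetry set of $\eta_d$ is (the image of) $M$. (2) For every oval $\eta$, the area evolute of $\eta$ is contained in the region bounded by its center symmetry set, i.e. in the complement of the unbounded connected component of the complement of the center symmetry set. -/

import Mathlib

open scoped ContDiff

noncomputable section

/-- The Euclidean plane. -/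
abbrev Plane : Type := EuclideanSpace ℝ (Fin 2)

/-- The determinant `[w₁, w₂]` of the matrix with columns `w₁`, `w₂`. -/
def bracket (w₁ w₂ : Plane) : ℝ := w₁ 0 * w₂ 1 - w₁ 1 * w₂ 0

/-- The unit vector `e_θ = (-sin θ, cos θ)`. -/
def eTheta (θ : ℝ) : Plane := !₂[-Real.sin θ, Real.cos θ]

/-- A smooth closed strictly convex plane curve of strictly positive curvature, parameterized by
its tangent direction: `γ'(θ)` is a positive multiple `r(θ) e_θ` of `e_θ`, and `1 / r(θ)` is the
curvature at `γ(θ)`. -/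
structure IsOval (γ : ℝ → Plane) : Prop where
  smooth : ContDiff ℝ ∞ γ
  periodic : Function.Periodic γ (2 * Real.pi)
  tangent : ∀ θ : ℝ, ∃ r : ℝ, 0 < r ∧ deriv γ θ = r • eTheta θ

/-- The chord joining the points of parameters `s`, `t` of a regular curve is a diameter:
its end points are distinct and the tangents there are parallel. -/
def IsDiameter (γ : ℝ → Plane) (s t : ℝ) : Prop :=
  γ s ≠ γ t ∧ bracket (deriv γ s) (deriv γ t) = 0

/-- The area evolute of a curve: the set of midpoints of its diameters. -/
def areaEvolute (γ : ℝ → Plane) : Set Plane :=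
  {X | ∃ s t : ℝ, IsDiameter γ s t ∧ X = midpoint ℝ (γ s) (γ t)}

/-- The center symmetry set of a curve: the envelope of the lines spanned by its diameters.
Near a diameter the family of diameters is written `x ↦ (x, τ x)`; its lines are
`F(x, X) = [X - γ x, γ x - γ (τ x)] = 0`, and the envelope is given by `F = 0`, `∂F/∂x = 0`. -/
def centerSymmetrySet (γ : ℝ → Plane) : Set Plane :=
  {X | ∃ (s : ℝ) (τ : ℝ → ℝ), DifferentiableAt ℝ τ s ∧
    (∀ᶠ x in nhds s, IsDiameter γ x (τ x)) ∧
    bracket (X - γ s) (γ s - γ (τ s)) = 0 ∧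
    deriv (fun x : ℝ => bracket (X - γ x) (γ x - γ (τ x))) s = 0}

/-- The curve `M(θ) = (γ(θ) + γ(θ + π)) / 2`. -/
def curveM (γ : ℝ → Plane) (θ : ℝ) : Plane :=
  (1 / 2 : ℝ) • (γ θ + γ (θ + Real.pi))

/-- The symmetric curve `u`, homothetic with ratio `k` to `(γ(θ) - γ(θ + π)) / 2`. -/
def curveU (γ : ℝ → Plane) (k : ℝ) (θ : ℝ) : Plane :=
  k • (1 / 2 : ℝ) • (γ θ - γ (θ + Real.pi))

/-- The dual curve `v = u' / [u, u']`. -/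
def curveV (γ : ℝ → Plane) (k : ℝ) (θ : ℝ) : Plane :=
  (bracket (curveU γ k θ) (deriv (curveU γ k) θ))⁻¹ • deriv (curveU γ k) θ

/-- The `u`-curvature radius `α` of `M`, i.e. the solution of `M' = α u'`. -/
def alpha (γ : ℝ → Plane) (k : ℝ) (θ : ℝ) : ℝ :=
  bracket (curveU γ k θ) (deriv (curveM γ) θ) /
    bracket (curveU γ k θ) (deriv (curveU γ k) θ)

/-- `β(θ) = (1/2) ∫_θ^{θ+π} α(s) [u, u'](s) ds`. -/
def beta (γ : ℝ → Plane) (k : ℝ) (θ : ℝ) : ℝ :=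
  (1 / 2 : ℝ) * ∫ s in θ..(θ + Real.pi),
    alpha γ k s * bracket (curveU γ k s) (deriv (curveU γ k) s)

/-- The involute `N = M + β v` of `M`. -/
def curveN (γ : ℝ → Plane) (k : ℝ) (θ : ℝ) : Plane :=
  curveM γ θ + beta γ k θ • curveV γ k θ

/-- The `v`-equidistant `η_d = N + d v` of `N`. -/
def curveEta (γ : ℝ → Plane) (k d : ℝ) (θ : ℝ) : Plane :=
  curveN γ k θ + d • curveV γ k θ

/-- The exterior of `M` seen from `γ`: the points that can be reached from a point of `γ` by a
continuous path avoiding `M`. -/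
def exteriorFrom (γ M : ℝ → Plane) : Set Plane :=
  {p | ∃ θ : ℝ, JoinedIn (Set.range M)ᶜ (γ θ) p}

/-- The region bounded by a compact planar set `K`: the complement of the unbounded connected
component of `Kᶜ`. -/
def boundedRegion (K : Set Plane) : Set Plane :=
  {p | p ∉ K → Bornology.IsBounded (connectedComponentIn Kᶜ p)}

end

/-! ### Algebra and calculus of the determinant. -/

section Bracket

/-! Both inclusions come from `involute_mem_boundedRegion`, which counts tangents. Let `K` have
tangent direction `a`, turning locally convexly with `a (θ + π) = -a θ`. The tangents of `K` through
`p` are the zeros of the antiperiodic function `[p - K θ, a θ]`, and off `K` all zeros are simple.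
Having a single tangent per half period (`NonnegOnHalfPeriod`) is therefore an open and closed
condition on the complement of `K`, and it holds far away. So the points with several tangents form
a bounded union of components. A point `N t` of an involute lies on the tangent at `t`, and Rolle's
theorem on `[t, t + π]` gives it a second one.

The duality `u' = ρ v`, `v' = -φ u` supplies two instances. For (1b), `K = M` with direction `v`,
and `N` is its involute. For (2), `K = M - α u` with direction `u` is the center symmetry set, and
`M` is its involute. The passage to `exteriorFrom` in (1b) uses that off `M` each point of the oval
starts an outward ray missing `M`. -/

theorem bracket_add_left (x y z : Plane) : bracket (x + y) z = bracket x z + bracket y z := by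
  simp [bracket]; ring

theorem bracket_sub_left (x y z : Plane) : bracket (x - y) z = bracket x z - bracket y z := by
  simp [bracket]; ring

theorem bracket_smul_left (c : ℝ) (x y : Plane) : bracket (c • x) y = c * bracket x y := by
  simp [bracket]; ring

theorem bracket_smul_right (c : ℝ) (x y : Plane) : bracket x (c • y) = c * bracket x y := by
  simp [bracket]; ring

theorem bracket_neg_left (x y : Plane) : bracket (-x) y = -bracket x y := by
  simp [bracket]; ring

theorem bracket_neg_right (x y : Plane) : bracket x (-y) = -bracket x y := by
  simp [bracket]; ring

@[simp] theorem bracket_self (x : Plane) : bracket x x = 0 := by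
  simp [bracket]; ring

@[simp] theorem bracket_zero_left (x : Plane) : bracket 0 x = 0 := by
  simp [bracket]

theorem bracket_comm (x y : Plane) : bracket x y = -bracket y x := by
  simp [bracket]; ring

/-- The Cramer rule in the plane. -/
theorem bracket_smul_eq (x y z : Plane) :
    bracket x y • z = bracket z y • x + bracket x z • y := by
  ext i; fin_cases i <;> simp [bracket] <;> ring

theorem eq_zero_of_bracket_eq_zero {x y z : Plane} (h : bracket x y ≠ 0)
    (hx : bracket z x = 0) (hy : bracket z y = 0) : z = 0 := by
  have := bracket_smul_eq x y z
  rw [hy, bracket_comm x z, hx] at this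
  simpa [h] using this

theorem continuous_bracket : Continuous fun p : Plane × Plane => bracket p.1 p.2 := by
  unfold bracket; fun_prop

theorem Continuous.bracket {X : Type*} [TopologicalSpace X] {f g : X → Plane}
    (hf : Continuous f) (hg : Continuous g) : Continuous fun x => bracket (f x) (g x) :=
  continuous_bracket.comp (hf.prodMk hg)

theorem HasDerivAt.plane_apply {f : ℝ → Plane} {f' : Plane} {x : ℝ} (hf : HasDerivAt f f' x)
    (i : Fin 2) : HasDerivAt (fun y => f y i) (f' i) x :=
  (EuclideanSpace.proj i : Plane →L[ℝ] ℝ).hasFDerivAt.comp_hasDerivAt x hf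

theorem HasDerivAt.bracket {f g : ℝ → Plane} {f' g' : Plane} {x : ℝ} (hf : HasDerivAt f f' x)
    (hg : HasDerivAt g g' x) :
    HasDerivAt (fun y => bracket (f y) (g y)) (bracket f' (g x) + bracket (f x) g') x := by
  unfold _root_.bracket
  convert! ((hf.plane_apply 0).mul (hg.plane_apply 1)).sub
    ((hf.plane_apply 1).mul (hg.plane_apply 0)) using 1
  ring

end Bracket

/-! ### Antiperiodic functions with one sign change per half period. -/

section HalfPeriod

open Set Filter Topology

/-- The function `f` is nonnegative on an interval of length `π`. -/
def NonnegOnHalfPeriod (f : ℝ → ℝ) : Prop :=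
  ∃ a : ℝ, ∀ θ ∈ Icc a (a + Real.pi), 0 ≤ f θ

theorem Function.Antiperiodic.eq_zero_sub_int_mul {f : ℝ → ℝ} {c : ℝ}
    (hf : Function.Antiperiodic f c) {x : ℝ} (n : ℤ) : f (x - n * c) = 0 ↔ f x = 0 := by
  rw [hf.sub_int_mul_eq]
  simp

theorem Function.Antiperiodic.exists_mem_Ico_eq_zero {f : ℝ → ℝ}
    (hf : Function.Antiperiodic f Real.pi) {x : ℝ} (hx : f x = 0) (a : ℝ) :
    ∃ n : ℤ, x - n * Real.pi ∈ Ico a (a + Real.pi) ∧ f (x - n * Real.pi) = 0 := by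
  refine ⟨toIcoDiv Real.pi_pos a x, ?_, (hf.eq_zero_sub_int_mul _).2 hx⟩
  simpa using sub_toIcoDiv_zsmul_mem_Ico Real.pi_pos a x

theorem Function.Antiperiodic.exists_eq_zero {f : ℝ → ℝ} (hf : Function.Antiperiodic f Real.pi)
    (hc : Continuous f) : ∃ x, f x = 0 := by
  have h := hf 0
  rw [zero_add] at h
  rcases le_total (f 0) 0 with h0 | h0
  · exact mem_range_of_exists_le_of_exists_ge hc ⟨0, h0⟩ ⟨Real.pi, by linarith⟩
  · exact mem_range_of_exists_le_of_exists_ge hc ⟨Real.pi, by linarith⟩ ⟨0, h0⟩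

/-- A continuous antiperiodic function with a single zero per half period has constant sign on
some half period. -/
theorem nonnegOnHalfPeriod_of_ne_zero {f : ℝ → ℝ} (hf : Function.Antiperiodic f Real.pi)
    (hc : Continuous f) {a : ℝ} (ha : f a = 0) (hne : ∀ θ ∈ Ioo a (a + Real.pi), f θ ≠ 0) :
    NonnegOnHalfPeriod f := by
  have hpi := Real.pi_pos
  have ha' : f (a + Real.pi) = 0 := by rw [hf a, ha, neg_zero]
  have hsign : (∀ θ ∈ Ioo a (a + Real.pi), 0 < f θ) ∨ ∀ θ ∈ Ioo a (a + Real.pi), f θ < 0 := by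
    by_contra! hcon
    obtain ⟨⟨x, hx, hfx⟩, y, hy, hfy⟩ := hcon
    obtain ⟨z, hz, hfz⟩ := (isPreconnected_Ioo (a := a) (b := a + Real.pi)).intermediate_value
      hx hy hc.continuousOn ⟨hfx, hfy⟩
    exact hne z hz hfz
  rcases hsign with h | h
  · refine ⟨a, fun θ hθ => ?_⟩
    rcases eq_or_lt_of_le hθ.1 with h1 | h1
    · rw [← h1, ha]
    rcases eq_or_lt_of_le hθ.2 with h2 | h2
    · rw [h2, ha']
    exact (h θ ⟨h1, h2⟩).le
  -- The next half period carries the opposite sign.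
  · refine ⟨a + Real.pi, fun θ hθ => ?_⟩
    have hs : f θ = -f (θ - Real.pi) := by rw [hf.sub_eq, neg_neg]
    rw [hs]
    rcases eq_or_lt_of_le hθ.1 with h1 | h1
    · rw [← h1]; simp [ha]
    rcases eq_or_lt_of_le hθ.2 with h2 | h2
    · rw [h2]; simp [ha']
    linarith [h (θ - Real.pi) ⟨by linarith, by linarith⟩]

/-- If all zeros of `f` are simple, then `f` is positive inside a half period on which it is
nonnegative, and increases strictly through its left end point. -/
theorem NonnegOnHalfPeriod.exists_pos {f f' : ℝ → ℝ} (h : NonnegOnHalfPeriod f)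
    (hf : Function.Antiperiodic f Real.pi) (hd : ∀ θ, HasDerivAt f (f' θ) θ)
    (hs : ∀ θ, f θ = 0 → f' θ ≠ 0) :
    ∃ a, f a = 0 ∧ 0 < f' a ∧ ∀ θ ∈ Ioo a (a + Real.pi), 0 < f θ := by
  have hpi := Real.pi_pos
  obtain ⟨a, ha⟩ := h
  have h1 := ha a ⟨le_rfl, by linarith⟩
  have h2 := ha (a + Real.pi) ⟨by linarith, le_rfl⟩
  rw [hf a] at h2
  have h0 : f a = 0 := by linarith
  refine ⟨a, h0, lt_of_le_of_ne ?_ (hs a h0).symm, fun θ hθ => ?_⟩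
  · by_contra! hneg
    have hlt := (hd a).hasDerivWithinAt (s := Ioi a)
    have := (hasDerivWithinAt_iff_tendsto_slope' (lt_irrefl a)).1 hlt
    have hev : ∀ᶠ x in 𝓝[>] a, slope f a x < 0 := this.eventually (gt_mem_nhds hneg)
    have hev2 : ∀ᶠ x in 𝓝[>] a, x ∈ Ioo a (a + Real.pi) :=
      Ioo_mem_nhdsGT (by linarith)
    obtain ⟨x, hx1, hx2⟩ := (hev.and hev2).exists
    rw [slope_def_field, h0, sub_zero] at hx1
    have := div_nonneg (ha x ⟨hx2.1.le, hx2.2.le⟩) (sub_nonneg.2 hx2.1.le)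
    linarith
  · refine lt_of_le_of_ne (ha θ ⟨hθ.1.le, hθ.2.le⟩) fun hz => ?_
    -- An interior zero of a nonnegative function is a minimum, hence not simple.
    have hmin : IsLocalMin f θ := by
      filter_upwards [Ioo_mem_nhds hθ.1 hθ.2] with x hx
      rw [← hz]
      exact ha x ⟨hx.1.le, hx.2.le⟩
    exact hs θ hz.symm (hmin.hasDerivAt_eq_zero (hd θ))

theorem NonnegOnHalfPeriod.not_two_zeros {f f' : ℝ → ℝ} (h : NonnegOnHalfPeriod f)
    (hf : Function.Antiperiodic f Real.pi) (hd : ∀ θ, HasDerivAt f (f' θ) θ)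
    (hs : ∀ θ, f θ = 0 → f' θ ≠ 0) {s t : ℝ} (hst : s < t) (hts : t < s + Real.pi)
    (h1 : f s = 0) (h2 : f t = 0) : False := by
  obtain ⟨a, -, -, hpos⟩ := h.exists_pos hf hd hs
  have key : ∀ x, f x = 0 → ∃ n : ℤ, x = a + n * Real.pi := by
    intro x hx
    obtain ⟨n, hn, hz⟩ := hf.exists_mem_Ico_eq_zero hx a
    refine ⟨n, ?_⟩
    rcases eq_or_lt_of_le hn.1 with h | h
    · linarith
    · exact absurd hz (hpos _ ⟨h, hn.2⟩).ne'
  obtain ⟨m, hm⟩ := key s h1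
  obtain ⟨n, hn⟩ := key t h2
  have hpi := Real.pi_pos
  have e1 : (0 : ℝ) < ((n - m : ℤ) : ℝ) := by
    push_cast
    by_contra! hcon
    nlinarith
  have e2 : ((n - m : ℤ) : ℝ) < 1 := by
    push_cast
    by_contra! hcon
    nlinarith
  have e1' : (0 : ℤ) < n - m := by exact_mod_cast e1
  have e2' : n - m < (1 : ℤ) := by exact_mod_cast e2
  omega

variable {Y : Type*} [TopologicalSpace Y]

/-- By `2π`-periodicity the left end may be taken in the compact interval `[0, 2π]`, and projection
along a compact factor is a closed map. -/
theorem isClosed_nonnegOnHalfPeriod {G : Y → ℝ → ℝ} (hG : Continuous fun p : Y × ℝ => G p.1 p.2)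
    (hanti : ∀ y, Function.Antiperiodic (G y) Real.pi) :
    IsClosed {y | NonnegOnHalfPeriod (G y)} := by
  have hpi := Real.pi_pos
  set S : Set (Icc (0 : ℝ) (2 * Real.pi) × Y) :=
    {q | ∀ x ∈ Icc (0 : ℝ) Real.pi, 0 ≤ G q.2 (q.1 + x)} with hS
  have hclosed : IsClosed S := by
    simp only [hS, ofPred_forall]
    refine isClosed_iInter fun x => isClosed_iInter fun _ => ?_
    refine isClosed_le continuous_const ?_
    exact hG.comp (by fun_prop : Continuous fun q : Icc (0 : ℝ) (2 * Real.pi) × Y =>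
      (q.2, (q.1 : ℝ) + x))
  have himg : {y | NonnegOnHalfPeriod (G y)} = Prod.snd '' S := by
    ext y
    constructor
    · rintro ⟨a, ha⟩
      have hper : Function.Periodic (G y) (2 * Real.pi) := (hanti y).periodic_two_mul
      have hmem := sub_toIcoDiv_zsmul_mem_Ico Real.two_pi_pos (0 : ℝ) a
      set n := toIcoDiv Real.two_pi_pos (0 : ℝ) a
      rw [zero_add] at hmem
      refine ⟨(⟨a - n • (2 * Real.pi), hmem.1, hmem.2.le⟩, y), fun x hx => ?_, rfl⟩
      have : a - n • (2 * Real.pi) + x = a + x - n • (2 * Real.pi) := by ring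
      simp only [this]
      rw [hper.sub_zsmul_eq]
      exact ha _ ⟨by linarith [hx.1], by linarith [hx.2]⟩
    · rintro ⟨⟨a, y'⟩, h, rfl⟩
      refine ⟨a, fun θ hθ => ?_⟩
      have := h (θ - a) ⟨by linarith [hθ.1], by linarith [hθ.2]⟩
      simpa using this
  rw [himg]
  exact isClosedMap_snd_of_compactSpace _ hclosed

/-- A simple zero moves only slightly under perturbation: `G y` stays increasing near `a`, and by
compactness it stays positive on the rest of the half period. -/
theorem eventually_nonnegOnHalfPeriod {G G' : Y → ℝ → ℝ}
    (hG : Continuous fun p : Y × ℝ => G p.1 p.2) (hG' : Continuous fun p : Y × ℝ => G' p.1 p.2)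
    (hanti : ∀ y, Function.Antiperiodic (G y) Real.pi)
    (hd : ∀ y θ, HasDerivAt (G y) (G' y θ) θ) {y₀ : Y} (hs : ∀ θ, G y₀ θ = 0 → G' y₀ θ ≠ 0)
    (h : NonnegOnHalfPeriod (G y₀)) : ∀ᶠ y in 𝓝 y₀, NonnegOnHalfPeriod (G y) := by
  have hpi := Real.pi_pos
  obtain ⟨a, -, hda, hpos⟩ := h.exists_pos (hanti y₀) (hd y₀) hs
  have h1 : ∀ᶠ p : Y × ℝ in 𝓝 y₀ ×ˢ 𝓝 a, 0 < G' p.1 p.2 := by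
    rw [← nhds_prod_eq]
    exact hG'.continuousAt.eventually (lt_mem_nhds hda)
  obtain ⟨A, hA, B, hB, hAB⟩ := eventually_prod_iff.1 h1
  obtain ⟨ε, hε, hεB⟩ := Metric.eventually_nhds_iff.1 hB
  -- `δ < ε` keeps `[a - δ, a + δ]` where the derivative is positive; `δ < π / 2` makes the middle
  -- interval nonempty.
  obtain ⟨δ, hδ, hδ2⟩ := exists_between (lt_min hε (half_pos hpi))
  have hδε := hδ2.trans_le (min_le_left _ _)
  have hδpi := hδ2.trans_le (min_le_right _ _)
  have h2 : ∀ᶠ y in 𝓝 y₀, ∀ θ ∈ Icc (a + δ) (a + Real.pi - δ), 0 < G y θ := by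
    refine isCompact_Icc.eventually_forall_of_forall_eventually fun θ hθ => ?_
    exact hG.continuousAt.eventually (lt_mem_nhds
      (hpos θ ⟨by linarith [hθ.1], by linarith [hθ.2]⟩))
  filter_upwards [hA, h2] with y hy1 hy2
  have hmono : StrictMonoOn (G y) (Icc (a - δ) (a + δ)) := by
    refine strictMonoOn_of_deriv_pos (convex_Icc _ _)
      (fun x _ => (hd y x).continuousAt.continuousWithinAt) fun x hx => ?_
    rw [interior_Icc] at hx
    rw [(hd y x).deriv]
    refine hAB hy1 (hεB ?_)
    rw [Real.dist_eq, abs_lt]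
    exact ⟨by linarith [hx.1], by linarith [hx.2]⟩
  have hr : 0 < G y (a + δ) := hy2 _ ⟨le_rfl, by linarith⟩
  have hl : G y (a - δ) < 0 := by
    have := hy2 (a + Real.pi - δ) ⟨by linarith, le_rfl⟩
    have e : a + Real.pi - δ = a - δ + Real.pi := by ring
    rw [e, hanti y] at this
    linarith
  obtain ⟨b, hb, hzb⟩ := intermediate_value_Icc (by linarith : a - δ ≤ a + δ)
    (fun x _ => (hd y x).continuousAt.continuousWithinAt) ⟨hl.le, hr.le⟩
  refine ⟨b, fun θ hθ => ?_⟩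
  rcases le_total θ (a + δ) with c1 | c1
  · rw [← hzb]
    exact hmono.monotoneOn hb ⟨by linarith [hθ.1, hb.1], c1⟩ hθ.1
  rcases le_total θ (a + Real.pi - δ) with c2 | c2
  · exact (hy2 θ ⟨c1, c2⟩).le
  · have e : G y (θ - Real.pi) ≤ G y b :=
      hmono.monotoneOn ⟨by linarith, by linarith [hθ.2, hb.2]⟩ hb (by linarith [hθ.2])
    rw [hzb, (hanti y).sub_eq] at e
    linarith

end HalfPeriod

/-! ### Counting tangents through a point of an involute. -/

open Set Filter Topology in
/-- Let the curve `K` have tangent direction `a`, where `a` is a locally convex antiperiodic curve,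
and let `N` be an involute of `K`: the point `N θ` lies on the tangent of `K` at `θ`, and the
function `[N t - N θ, a θ]` is, up to a nonvanishing factor, a derivative in `θ` of
`[N t - N θ, b θ]`. Then `N` lies in the region bounded by `K`. -/
theorem involute_mem_boundedRegion {K N a a' b : ℝ → Plane} {μ κ : ℝ → ℝ}
    (hK : ∀ θ, HasDerivAt K (μ θ • a θ) θ) (hKp : Function.Periodic K Real.pi)
    (ha : ∀ θ, HasDerivAt a (a' θ) θ) (hac : Continuous a')
    (haa : ∀ θ, bracket (a θ) (a' θ) ≠ 0) (hap : Function.Antiperiodic a Real.pi)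
    (hab : ∀ s t, s < t → t < s + Real.pi → bracket (a s) (a t) ≠ 0)
    (hNp : Function.Periodic N Real.pi) (hNK : ∀ θ, bracket (N θ - K θ) (a θ) = 0)
    (hκ : ∀ θ, κ θ ≠ 0)
    (hb : ∀ t θ, HasDerivAt (fun x => bracket (N t - N x) (b x))
      (κ θ * bracket (N t - N θ) (a θ)) θ) (t : ℝ) :
    N t ∈ boundedRegion (range K) := by
  have hpi := Real.pi_pos
  have hKc : Continuous K := continuous_iff_continuousAt.2 fun θ => (hK θ).continuousAt
  have hacc : Continuous a := continuous_iff_continuousAt.2 fun θ => (ha θ).continuousAt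
  -- Homogeneous coordinates: `(1, p)` is the point `p`, and `(0, q)` is the point at infinity in
  -- direction `q`. This lets perturbation from infinity handle distant points.
  set G : ℝ × Plane → ℝ → ℝ := fun y θ => bracket (y.2 - y.1 • K θ) (a θ) with hGdef
  set G' : ℝ × Plane → ℝ → ℝ := fun y θ => bracket (y.2 - y.1 • K θ) (a' θ) with hGdef'
  have hG : Continuous fun p : (ℝ × Plane) × ℝ => G p.1 p.2 :=
    Continuous.bracket (by fun_prop) (by fun_prop)
  have hG' : Continuous fun p : (ℝ × Plane) × ℝ => G' p.1 p.2 :=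
    Continuous.bracket (by fun_prop) (by fun_prop)
  have hanti : ∀ y, Function.Antiperiodic (G y) Real.pi := fun y θ => by
    simp only [hGdef]
    rw [hKp θ, hap θ, bracket_neg_right]
  -- The term from `K'` vanishes because `K'` is a multiple of `a`.
  have hd : ∀ y θ, HasDerivAt (G y) (G' y θ) θ := fun y θ => by
    have := HasDerivAt.bracket (((hK θ).const_smul y.1).const_sub y.2) (ha θ)
    convert! this using 1
    simp only [hGdef', bracket_neg_left, bracket_smul_left, bracket_self,
      Pi.smul_apply]
    ring
  have hcont : ∀ y, Continuous (G y) := fun y =>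
    continuous_iff_continuousAt.2 fun θ => (hd y θ).continuousAt
  have hsimple : ∀ p ∉ range K, ∀ θ, G (1, p) θ = 0 → G' (1, p) θ ≠ 0 := by
    intro p hp θ h1 h2
    have := eq_zero_of_bracket_eq_zero (haa θ) h1 h2
    rw [one_smul, sub_eq_zero] at this
    exact hp ⟨θ, this.symm⟩
  have hinf : ∀ q : Plane, q ≠ 0 → ∀ θ, G (0, q) θ = 0 → G' (0, q) θ ≠ 0 := by
    intro q hq θ h1 h2
    have := eq_zero_of_bracket_eq_zero (haa θ) h1 h2
    rw [zero_smul, sub_zero] at this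
    exact hq this
  have hfar : ∀ q : Plane, q ≠ 0 → NonnegOnHalfPeriod (G (0, q)) := by
    intro q hq
    obtain ⟨x, hx⟩ := (hanti (0, q)).exists_eq_zero (hcont _)
    refine nonnegOnHalfPeriod_of_ne_zero (hanti _) (hcont _) hx fun θ hθ h => hq ?_
    simp only [hGdef, zero_smul, sub_zero] at hx h
    exact eq_zero_of_bracket_eq_zero (hab x θ hθ.1 hθ.2) hx h
  have hev : ∀ᶠ ε : ℝ in 𝓝 0, ∀ q ∈ Metric.sphere (0 : Plane) 1,
      NonnegOnHalfPeriod (G (ε, q)) := by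
    refine (isCompact_sphere _ _).eventually_forall_of_forall_eventually fun q hq => ?_
    have hq0 : q ≠ 0 := ne_zero_of_mem_unit_sphere (⟨q, hq⟩ : Metric.sphere (0 : Plane) 1)
    exact eventually_nonnegOnHalfPeriod hG hG' hanti hd (hinf q hq0) (hfar q hq0)
  obtain ⟨ε, hε, hεW⟩ := Metric.eventually_nhds_iff.1 hev
  have hbdd : Bornology.IsBounded {p : Plane | ¬NonnegOnHalfPeriod (G (1, p))} := by
    refine (Metric.isBounded_closedBall (x := (0 : Plane)) (r := ε⁻¹)).subset fun p hp => ?_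
    by_contra hcon
    rw [mem_closedBall_zero_iff, not_le] at hcon
    have hp0 : 0 < ‖p‖ := (inv_pos.2 hε).trans hcon
    -- Dividing by `‖p‖` turns `(1, p)` into `(‖p‖⁻¹, p / ‖p‖)`, close to the unit circle at
    -- infinity, and preserves signs.
    have hW := @hεW ‖p‖⁻¹ (by
      rw [Real.dist_eq, sub_zero, abs_of_pos (inv_pos.2 hp0)]
      exact inv_lt_of_inv_lt₀ hε hcon) (‖p‖⁻¹ • p) (by
      rw [mem_sphere_zero_iff_norm, norm_smul, norm_inv, norm_norm, inv_mul_cancel₀ hp0.ne'])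
    refine hp ?_
    obtain ⟨c, hc⟩ := hW
    refine ⟨c, fun θ hθ => ?_⟩
    have := hc θ hθ
    simp only [hGdef] at this ⊢
    rw [← smul_sub, bracket_smul_left] at this
    rw [one_smul]
    exact nonneg_of_mul_nonneg_right this (inv_pos.2 hp0)
  intro hNt
  have hnot : ¬NonnegOnHalfPeriod (G (1, N t)) := by
    intro hW
    -- The function vanishes at both ends since `N (t + π) = N t`; its critical point `s` is a
    -- second tangent through `N t`, besides the one at `t`.
    have hrolle : ∃ s ∈ Ioo t (t + Real.pi), κ s * bracket (N t - N s) (a s) = 0 := by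
      refine exists_hasDerivAt_eq_zero (f := fun x => bracket (N t - N x) (b x)) (by linarith)
        (fun x _ => (hb t x).continuousAt.continuousWithinAt) ?_ fun x _ => hb t x
      simp [hNp t]
    obtain ⟨s, hs, hs0⟩ := hrolle
    have hzero : ∀ θ, G (1, N t) θ = bracket (N t - N θ) (a θ) := by
      intro θ
      have e : N t - (1 : ℝ) • K θ = (N t - N θ) + (N θ - K θ) := by rw [one_smul]; abel
      simp only [hGdef, e, bracket_add_left, hNK, add_zero]
    refine hW.not_two_zeros (hanti _) (hd _) (hsimple _ hNt) hs.1 hs.2 ?_ ?_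
    · simp [hzero]
    · rw [hzero]
      exact (mul_eq_zero.1 hs0).resolve_left (hκ s)
  refine hbdd.subset ?_
  have hcl : IsClosed {p : Plane | NonnegOnHalfPeriod (G (1, p))} :=
    (isClosed_nonnegOnHalfPeriod hG hanti).preimage (by fun_prop : Continuous fun p : Plane =>
      ((1 : ℝ), p))
  -- The component of `N t` avoids `K`, where the one-tangent condition is open and closed, so it
  -- stays among the points with several tangents.
  refine IsPreconnected.subset_left_of_subset_union (u := {p : Plane | ¬NonnegOnHalfPeriod
    (G (1, p))}) (v := interior {p : Plane | NonnegOnHalfPeriod (G (1, p))})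
    hcl.isOpen_compl isOpen_interior ?_ ?_ ?_ isPreconnected_connectedComponentIn
  · exact Set.disjoint_left.2 fun p h1 h2 => by
      have h3 : p ∈ {p : Plane | NonnegOnHalfPeriod (G (1, p))} := interior_subset h2
      exact h1 h3
  · intro p hp
    by_cases hW : NonnegOnHalfPeriod (G (1, p))
    · right
      rw [mem_interior_iff_mem_nhds]
      have := eventually_nonnegOnHalfPeriod hG hG' hanti hd
        (hsimple p (connectedComponentIn_subset _ _ hp)) hW
      exact (by fun_prop : Continuous fun p : Plane =>
        ((1 : ℝ), p)).continuousAt.eventually this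
    · exact Or.inl hW
  · exact ⟨N t, mem_connectedComponentIn hNt, hnot⟩

/-! ### Diameters, midpoints and envelopes. -/

section Diameters

variable {η b : ℝ → Plane} {ρ : ℝ → ℝ}

theorem isDiameter_add_pi (hd : ∀ θ, deriv η θ = ρ θ • b θ)
    (hbp : Function.Antiperiodic b Real.pi) (hne : ∀ θ, η θ ≠ η (θ + Real.pi)) (θ : ℝ) :
    IsDiameter η θ (θ + Real.pi) := by
  refine ⟨hne θ, ?_⟩
  rw [hd, hd, hbp θ]
  simp [bracket_smul_left, bracket_smul_right, bracket_neg_right]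

/-- Tangents are parallel only when the parameters differ by a multiple of `π`; an even multiple
gives the same point. -/
theorem IsDiameter.eq_add_pi (hper : Function.Periodic η (2 * Real.pi))
    (hd : ∀ θ, deriv η θ = ρ θ • b θ) (hρ : ∀ θ, ρ θ ≠ 0)
    (hbp : Function.Antiperiodic b Real.pi)
    (hb : ∀ s t, s < t → t < s + Real.pi → bracket (b s) (b t) ≠ 0) {s t : ℝ}
    (h : IsDiameter η s t) : η t = η (s + Real.pi) := by
  obtain ⟨hne, h0⟩ := h
  rw [hd, hd, bracket_smul_left, bracket_smul_right] at h0
  have h1 : bracket (b s) (b t) = 0 := by simpa [hρ] using h0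
  have hanti : Function.Antiperiodic (fun x => bracket (b s) (b x)) Real.pi := fun x => by
    simp only [hbp x, bracket_neg_right]
  obtain ⟨n, hn, hz⟩ := hanti.exists_mem_Ico_eq_zero h1 s
  have hst : t = s + n * Real.pi := by
    rcases eq_or_lt_of_le hn.1 with h | h
    · linarith
    · exact absurd hz (hb _ _ h hn.2)
  rcases Int.even_or_odd' n with ⟨m, rfl | rfl⟩
  · refine absurd ?_ hne
    have e : t = s + m * (2 * Real.pi) := by rw [hst]; push_cast; ring
    rw [e, hper.int_mul m]
  · have e : t = s + Real.pi + m * (2 * Real.pi) := by rw [hst]; push_cast; ring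
    rw [e, hper.int_mul m]

theorem areaEvolute_eq_range_curveM (hdiam : ∀ θ, IsDiameter η θ (θ + Real.pi))
    (hopp : ∀ s t, IsDiameter η s t → η t = η (s + Real.pi)) :
    areaEvolute η = Set.range (curveM η) := by
  have hmid : ∀ x y : Plane, midpoint ℝ x y = (1 / 2 : ℝ) • (x + y) := fun x y => by
    rw [midpoint_eq_smul_add, invOf_eq_inv, one_div]
  ext X
  constructor
  · rintro ⟨s, t, hst, rfl⟩
    exact ⟨s, by rw [hmid, hopp s t hst, curveM]⟩
  · rintro ⟨s, rfl⟩
    exact ⟨s, s + Real.pi, hdiam s, by rw [hmid, curveM]⟩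

/-- The envelope of a family of lines `[X - K θ, a θ] = 0` is `K`
when `a` is its tangent direction. -/
theorem centerSymmetrySet_eq_range {K a a' : ℝ → Plane} {μ : ℝ → ℝ} {C : ℝ} (hC : C ≠ 0)
    (hdiam : ∀ θ, IsDiameter η θ (θ + Real.pi))
    (hopp : ∀ s t, IsDiameter η s t → η t = η (s + Real.pi))
    (hK : ∀ θ, HasDerivAt K (μ θ • a θ) θ)
    (ha : ∀ θ, HasDerivAt a (a' θ) θ) (haa : ∀ θ, bracket (a θ) (a' θ) ≠ 0)
    (hline : ∀ X θ, bracket (X - η θ) (η θ - η (θ + Real.pi)) = C * bracket (X - K θ) (a θ)) :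
    centerSymmetrySet η = Set.range K := by
  have hder : ∀ X θ, deriv (fun x : ℝ => bracket (X - η x) (η x - η (x + Real.pi))) θ =
      C * bracket (X - K θ) (a' θ) := by
    intro X θ
    have h1 : (fun x : ℝ => bracket (X - η x) (η x - η (x + Real.pi))) =
        fun x => C * bracket (X - K x) (a x) := funext fun x => hline X x
    rw [h1, ((((hK θ).const_sub X).bracket (ha θ)).const_mul C).deriv]
    simp [bracket_neg_left, bracket_smul_left]
  ext X
  constructor
  · rintro ⟨s, τ, -, hτ, h0, h1⟩
    -- Whatever branch `τ` follows, `η (τ x)` is the opposite point `η (x + π)`.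
    have heq : (fun x : ℝ => bracket (X - η x) (η x - η (τ x))) =ᶠ[nhds s]
        fun x => bracket (X - η x) (η x - η (x + Real.pi)) := by
      filter_upwards [hτ] with x hx
      rw [hopp _ _ hx]
    rw [heq.deriv_eq, hder] at h1
    rw [hopp _ _ hτ.self_of_nhds, hline] at h0
    refine ⟨s, ?_⟩
    have := eq_zero_of_bracket_eq_zero (haa s) ((mul_eq_zero.1 h0).resolve_left hC)
      ((mul_eq_zero.1 h1).resolve_left hC)
    exact (sub_eq_zero.1 this).symm
  · rintro ⟨s, rfl⟩
    refine ⟨s, fun x => x + Real.pi, by fun_prop, Filter.Eventually.of_forall hdiam, ?_, ?_⟩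
    · rw [hline]; simp
    · rw [hder]; simp

end Diameters

/-! ### Support properties of an oval. -/

/-- The unit vector `(cos θ, sin θ)`. -/
noncomputable def nTheta (θ : ℝ) : Plane := !₂[Real.cos θ, Real.sin θ]

theorem bracket_nTheta_eTheta (θ : ℝ) : bracket (nTheta θ) (eTheta θ) = 1 := by
  simp only [bracket, nTheta, eTheta]
  simp
  nlinarith [Real.sin_sq_add_cos_sq θ]

theorem bracket_eTheta (s t : ℝ) : bracket (eTheta s) (eTheta t) = Real.sin (t - s) := by
  rw [Real.sin_sub]
  simp only [bracket, eTheta]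
  simp
  ring

theorem hasDerivAt_eTheta (θ : ℝ) : HasDerivAt eTheta (-nTheta θ) θ := by
  rw [hasDerivAt_iff_hasFDerivAt, ← hasFDerivWithinAt_univ, hasFDerivWithinAt_euclidean]
  intro i
  rw [hasFDerivWithinAt_univ, hasFDerivAt_iff_hasDerivAt]
  fin_cases i
  · simpa [eTheta, nTheta] using (Real.hasDerivAt_sin θ).fun_neg
  · simpa [eTheta, nTheta] using Real.hasDerivAt_cos θ

theorem antiperiodic_eTheta : Function.Antiperiodic eTheta Real.pi := fun θ => by
  ext i; fin_cases i <;> simp [eTheta]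

theorem bracket_eTheta_ne_zero {s t : ℝ} (hst : s < t) (hts : t < s + Real.pi) :
    bracket (eTheta s) (eTheta t) ≠ 0 := by
  rw [bracket_eTheta]
  exact (Real.sin_pos_of_pos_of_lt_pi (by linarith) (by linarith)).ne'

namespace IsOval

variable {γ : ℝ → Plane}

theorem exists_radius (h : IsOval γ) : ∃ r : ℝ → ℝ, (∀ θ, 0 < r θ) ∧ Differentiable ℝ r ∧
    Function.Periodic r (2 * Real.pi) ∧ ∀ θ, HasDerivAt γ (r θ • eTheta θ) θ := by
  choose r hr hd using h.tangent
  have hdiff : Differentiable ℝ γ := h.smooth.differentiable (by simp)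
  have hdiff2 : Differentiable ℝ (deriv γ) :=
    (contDiff_infty_iff_deriv.1 h.smooth).2.differentiable (by simp)
  have hr_eq : ∀ θ, r θ = bracket (nTheta θ) (deriv γ θ) := fun θ => by
    rw [hd, bracket_smul_right, bracket_nTheta_eTheta, mul_one]
  refine ⟨r, hr, ?_, ?_, fun θ => hd θ ▸ (hdiff θ).hasDerivAt⟩
  · rw [funext hr_eq]
    have h0 : Differentiable ℝ fun θ => deriv γ θ 0 :=
      fun θ => ((hdiff2 θ).hasDerivAt.plane_apply 0).differentiableAt
    have h1 : Differentiable ℝ fun θ => deriv γ θ 1 :=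
      fun θ => ((hdiff2 θ).hasDerivAt.plane_apply 1).differentiableAt
    have : (fun θ => bracket (nTheta θ) (deriv γ θ)) =
        fun θ => Real.cos θ * deriv γ θ 1 - Real.sin θ * deriv γ θ 0 := by
      funext θ; simp [bracket, nTheta]
    rw [this]
    fun_prop
  · intro θ
    have e : deriv γ (θ + 2 * Real.pi) = deriv γ θ := by
      rw [← deriv_comp_add_const, funext h.periodic]
    have en : nTheta (θ + 2 * Real.pi) = nTheta θ := by
      ext i; fin_cases i <;> simp [nTheta]
    rw [hr_eq, hr_eq, e, en]

/-- Pairing with `eTheta t` measures height along the outer normal `nTheta t`, so this is the depth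
of `γ x` below the tangent at `t`; the sign of the sine governs its monotonicity. -/
theorem hasDerivAt_bracket_sub_eTheta {r : ℝ → ℝ} (hd : ∀ θ, HasDerivAt γ (r θ • eTheta θ) θ)
    (t x : ℝ) : HasDerivAt (fun x => bracket (γ t - γ x) (eTheta t)) (r x * Real.sin (x - t)) x := by
  convert! ((hd x).const_sub (γ t)).bracket (hasDerivAt_const x (eTheta t)) using 1
  rw [bracket_neg_left, bracket_smul_left, bracket_eTheta, ← neg_sub, Real.sin_neg]
  simp [bracket]

theorem strictMonoOn_bracket_sub_eTheta (h : IsOval γ) (t : ℝ) :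
    StrictMonoOn (fun x => bracket (γ t - γ x) (eTheta t)) (Set.Icc t (t + Real.pi)) := by
  obtain ⟨r, hr, -, -, hd⟩ := h.exists_radius
  refine strictMonoOn_of_deriv_pos (convex_Icc _ _)
    (fun x _ => (hasDerivAt_bracket_sub_eTheta hd t x).continuousAt.continuousWithinAt)
    fun x hx => ?_
  rw [interior_Icc] at hx
  rw [(hasDerivAt_bracket_sub_eTheta hd t x).deriv]
  exact mul_pos (hr x) (Real.sin_pos_of_pos_of_lt_pi (by linarith [hx.1]) (by linarith [hx.2]))

theorem strictAntiOn_bracket_sub_eTheta (h : IsOval γ) (t : ℝ) :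
    StrictAntiOn (fun x => bracket (γ t - γ x) (eTheta t))
      (Set.Icc (t + Real.pi) (t + 2 * Real.pi)) := by
  obtain ⟨r, hr, -, -, hd⟩ := h.exists_radius
  refine strictAntiOn_of_deriv_neg (convex_Icc _ _)
    (fun x _ => (hasDerivAt_bracket_sub_eTheta hd t x).continuousAt.continuousWithinAt)
    fun x hx => ?_
  rw [interior_Icc] at hx
  rw [(hasDerivAt_bracket_sub_eTheta hd t x).deriv, ← Real.sin_sub_two_pi]
  exact mul_neg_of_pos_of_neg (hr x)
    (Real.sin_neg_of_neg_of_neg_pi_lt (by linarith [hx.2]) (by linarith [hx.1]))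

/-- The width of an oval is positive. -/
theorem width_pos (h : IsOval γ) (t : ℝ) : 0 < bracket (γ t - γ (t + Real.pi)) (eTheta t) := by
  have hpi := Real.pi_pos
  have := h.strictMonoOn_bracket_sub_eTheta t (Set.left_mem_Icc.2 (by linarith))
    (Set.right_mem_Icc.2 (by linarith)) (by linarith : t < t + Real.pi)
  simpa using this

/-- An oval lies on one side of each of its tangents. -/
theorem bracket_sub_eTheta_nonneg (h : IsOval γ) (t x : ℝ) :
    0 ≤ bracket (γ t - γ x) (eTheta t) := by
  have hpi := Real.pi_pos
  have key : ∀ y ∈ Set.Icc t (t + 2 * Real.pi), 0 ≤ bracket (γ t - γ y) (eTheta t) := by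
    intro y hy
    rcases le_total y (t + Real.pi) with c | c
    · have := (h.strictMonoOn_bracket_sub_eTheta t).monotoneOn (Set.left_mem_Icc.2 (by linarith))
        ⟨hy.1, c⟩ hy.1
      simpa using this
    · have := (h.strictAntiOn_bracket_sub_eTheta t).antitoneOn ⟨c, hy.2⟩
        (Set.right_mem_Icc.2 (by linarith)) hy.2
      simpa [h.periodic t] using this
  have hmem := sub_toIcoDiv_zsmul_mem_Ico Real.two_pi_pos t x
  have := key _ ⟨hmem.1, hmem.2.le⟩
  rwa [h.periodic.sub_zsmul_eq] at this

end IsOval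

/-! ### The dual curves `u` and `v`. -/

/-- Two antiperiodic curves dual to each other with respect to the determinant. -/
structure IsDualPair (u v : ℝ → Plane) (ρ φ : ℝ → ℝ) : Prop where
  left : ∀ θ, HasDerivAt u (ρ θ • v θ) θ
  right : ∀ θ, HasDerivAt v (-(φ θ • u θ)) θ
  bracket_eq_one : ∀ θ, bracket (u θ) (v θ) = 1
  antiperiodic_left : Function.Antiperiodic u Real.pi
  antiperiodic_right : Function.Antiperiodic v Real.pi
  left_pos : ∀ θ, 0 < ρ θ
  right_pos : ∀ θ, 0 < φ θ
  continuous_left : Continuous ρ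
  continuous_right : Continuous φ
  bracket_right_ne : ∀ s t, s < t → t < s + Real.pi → bracket (v s) (v t) ≠ 0

namespace IsDualPair

variable {u v : ℝ → Plane} {ρ φ : ℝ → ℝ}

/-- Otherwise `[u s, u ·]` vanishes at `s`, `t` and `s + π`. Rolle's theorem twice makes `u s`
parallel to two independent values of `v`, hence zero. -/
theorem bracket_left_ne (h : IsDualPair u v ρ φ) (s t : ℝ) (hst : s < t)
    (hts : t < s + Real.pi) : bracket (u s) (u t) ≠ 0 := by
  intro h0
  have hd : ∀ x, HasDerivAt (fun x => bracket (u s) (u x)) (ρ x * bracket (u s) (v x)) x := by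
    intro x
    have := (hasDerivAt_const x (u s)).bracket (h.left x)
    rwa [bracket_zero_left, zero_add, bracket_smul_right] at this
  have hc : Continuous fun x => bracket (u s) (u x) :=
    continuous_iff_continuousAt.2 fun x => (hd x).continuousAt
  obtain ⟨x, hx, hx0⟩ := exists_hasDerivAt_eq_zero hst hc.continuousOn (by simp [h0])
    fun x _ => hd x
  obtain ⟨y, hy, hy0⟩ := exists_hasDerivAt_eq_zero hts hc.continuousOn
    (by simp [h0, h.antiperiodic_left s, bracket_neg_right]) fun x _ => hd x
  have hus := eq_zero_of_bracket_eq_zero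
    (h.bracket_right_ne x y (hx.2.trans hy.1) (by linarith [hx.1, hy.2]))
    ((mul_eq_zero.1 hx0).resolve_left (h.left_pos x).ne')
    ((mul_eq_zero.1 hy0).resolve_left (h.left_pos y).ne')
  have := h.bracket_eq_one s
  simp [hus] at this

theorem continuous_u (h : IsDualPair u v ρ φ) : Continuous u :=
  continuous_iff_continuousAt.2 fun x => (h.left x).continuousAt

theorem continuous_v (h : IsDualPair u v ρ φ) : Continuous v :=
  continuous_iff_continuousAt.2 fun x => (h.right x).continuousAt

theorem bracket_left_deriv (h : IsDualPair u v ρ φ) (θ : ℝ) :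
    bracket (u θ) (ρ θ • v θ) = ρ θ := by
  rw [bracket_smul_right, h.bracket_eq_one, mul_one]

theorem bracket_right_deriv (h : IsDualPair u v ρ φ) (θ : ℝ) :
    bracket (v θ) (-(φ θ • u θ)) = φ θ := by
  rw [bracket_neg_right, bracket_smul_right, bracket_comm, h.bracket_eq_one]
  ring

end IsDualPair

/-- The curves `u` and `v` of an oval are dual, and `v` is a tangent direction of `M`. -/
theorem IsOval.exists_isDualPair {γ : ℝ → Plane} (h : IsOval γ) {k : ℝ} (hk : 0 < k) :
    ∃ ρ φ μ : ℝ → ℝ, IsDualPair (curveU γ k) (curveV γ k) ρ φ ∧ Differentiable ℝ ρ ∧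
      Differentiable ℝ μ ∧ Function.Antiperiodic μ Real.pi ∧
      ∀ θ, HasDerivAt (curveM γ) (μ θ • curveV γ k θ) θ := by
  obtain ⟨r, hr, hrd, hrp, hd⟩ := h.exists_radius
  have hγp : ∀ θ, γ (θ + Real.pi + Real.pi) = γ θ := fun θ => by
    rw [add_assoc, ← two_mul, h.periodic]
  have hrp' : ∀ θ, r (θ + Real.pi + Real.pi) = r θ := fun θ => by
    rw [add_assoc, ← two_mul, hrp]
  have hdpi : ∀ θ, HasDerivAt (fun x => γ (x + Real.pi)) (-(r (θ + Real.pi) • eTheta θ)) θ := by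
    intro θ
    have := (hd (θ + Real.pi)).comp_add_const θ Real.pi
    rwa [antiperiodic_eTheta θ, smul_neg] at this
  set u := curveU γ k with hu
  have huanti : Function.Antiperiodic u Real.pi := fun θ => by
    simp only [hu, curveU, hγp]
    module
  set σ : ℝ → ℝ := fun θ => k / 2 * (r θ + r (θ + Real.pi)) with hσ
  have hσpos : ∀ θ, 0 < σ θ := fun θ =>
    mul_pos (half_pos hk) (add_pos (hr _) (hr _))
  have hu' : ∀ θ, HasDerivAt u (σ θ • eTheta θ) θ := by
    intro θ
    convert! (((hd θ).sub (hdpi θ)).const_smul (1 / 2 : ℝ)).const_smul k using 1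
    simp only [hσ]
    module
  -- The support function of `u`. As `u' = σ e`, it gives `[u, u'] = σ ψ` and `v = e / ψ`.
  set ψ : ℝ → ℝ := fun θ => bracket (u θ) (eTheta θ) with hψ
  have hψpos : ∀ θ, 0 < ψ θ := by
    intro θ
    simp only [hψ, hu, curveU, bracket_smul_left]
    exact mul_pos hk (mul_pos (by norm_num) (h.width_pos θ))
  have hψ' : ∀ θ, HasDerivAt ψ (-bracket (u θ) (nTheta θ)) θ := by
    intro θ
    convert! (hu' θ).bracket (hasDerivAt_eTheta θ) using 1
    simp [bracket_smul_left, bracket_neg_right]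
  have hψd : Differentiable ℝ ψ := fun θ => (hψ' θ).differentiableAt
  have hψp : ∀ θ, ψ (θ + Real.pi) = ψ θ := fun θ => by
    simp only [hψ, huanti θ, antiperiodic_eTheta θ, bracket_neg_left, bracket_neg_right, neg_neg]
  have hσd : Differentiable ℝ σ := by fun_prop
  have hv : curveV γ k = fun θ => (ψ θ)⁻¹ • eTheta θ := by
    funext θ
    simp only [curveV, ← hu]
    rw [(hu' θ).deriv, bracket_smul_right, smul_smul]
    congr 1
    have := (hσpos θ).ne'
    have := (hψpos θ).ne'
    change (σ θ * ψ θ)⁻¹ * σ θ = _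
    field_simp
  refine ⟨fun θ => σ θ * ψ θ, fun θ => (ψ θ)⁻¹ ^ 2, fun θ => (r θ - r (θ + Real.pi)) / 2 * ψ θ,
    ⟨?_, ?_, ?_, huanti, ?_, ?_, ?_, ?_, ?_, ?_⟩, by fun_prop, by fun_prop, ?_, ?_⟩
  · intro θ
    rw [hv, smul_smul, mul_assoc, mul_inv_cancel₀ (hψpos θ).ne', mul_one]
    exact hu' θ
  · intro θ
    rw [hv]
    convert! ((hψ' θ).inv (hψpos θ).ne').smul (hasDerivAt_eTheta θ) using 1
    -- Expanding `u` in the frame `(n, e)` shows that `(e / ψ)'` is `-u / ψ ^ 2`.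
    have := bracket_smul_eq (nTheta θ) (eTheta θ) (u θ)
    rw [bracket_nTheta_eTheta, one_smul, bracket_comm (nTheta θ)] at this
    have h1 : u θ = ψ θ • nTheta θ + -bracket (u θ) (nTheta θ) • eTheta θ := this
    generalize bracket (u θ) (nTheta θ) = c at *
    rw [h1]
    have hne := (hψpos θ).ne'
    have e1 : (ψ θ)⁻¹ ^ 2 * ψ θ = (ψ θ)⁻¹ := by field_simp
    rw [smul_add, smul_smul, smul_smul, e1]
    have e2 : -(-c) / ψ θ ^ 2 = (ψ θ)⁻¹ ^ 2 * c := by field_simp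
    rw [e2]
    module
  · intro θ
    rw [hv, bracket_smul_right]
    exact inv_mul_cancel₀ (hψpos θ).ne'
  · intro θ
    rw [hv]
    simp only [hψp, antiperiodic_eTheta θ, smul_neg]
  · exact fun θ => mul_pos (hσpos θ) (hψpos θ)
  · exact fun θ => pow_pos (inv_pos.2 (hψpos θ)) 2
  · exact hσd.continuous.mul hψd.continuous
  · exact (hψd.continuous.inv₀ fun θ => (hψpos θ).ne').pow 2
  · intro s t hst hts
    rw [hv, bracket_smul_left, bracket_smul_right]
    exact mul_ne_zero (inv_ne_zero (hψpos s).ne')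
      (mul_ne_zero (inv_ne_zero (hψpos t).ne') (bracket_eTheta_ne_zero hst hts))
  · intro θ
    simp only [hψp, hrp']
    ring
  · intro θ
    rw [hv]
    convert! ((hd θ).add (hdpi θ)).const_smul (1 / 2 : ℝ) using 1
    rw [smul_smul, mul_assoc, mul_inv_cancel₀ (hψpos θ).ne']
    module

theorem IsOval.periodic_curveM {γ : ℝ → Plane} (h : IsOval γ) :
    Function.Periodic (curveM γ) Real.pi := fun θ => by
  simp only [curveM, add_assoc, ← two_mul, h.periodic θ]
  rw [add_comm]

/-! ### The involute `N` and its equidistants. -/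

section Involute

variable {γ : ℝ → Plane} {k : ℝ} {ρ φ μ : ℝ → ℝ}

theorem alpha_eq (hp : IsDualPair (curveU γ k) (curveV γ k) ρ φ)
    (hM : ∀ θ, HasDerivAt (curveM γ) (μ θ • curveV γ k θ) θ) (θ : ℝ) :
    alpha γ k θ = μ θ / ρ θ := by
  rw [alpha, (hM θ).deriv, (hp.left θ).deriv, hp.bracket_left_deriv, bracket_smul_right,
    hp.bracket_eq_one, mul_one]

theorem beta_eq (hp : IsDualPair (curveU γ k) (curveV γ k) ρ φ)
    (hM : ∀ θ, HasDerivAt (curveM γ) (μ θ • curveV γ k θ) θ) (θ : ℝ) :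
    beta γ k θ = (1 / 2 : ℝ) * ∫ s in θ..(θ + Real.pi), μ s := by
  rw [beta]
  congr 2
  funext s
  rw [alpha_eq hp hM, (hp.left s).deriv, hp.bracket_left_deriv,
    div_mul_cancel₀ _ (hp.left_pos s).ne']

theorem antiperiodic_beta (hp : IsDualPair (curveU γ k) (curveV γ k) ρ φ)
    (hM : ∀ θ, HasDerivAt (curveM γ) (μ θ • curveV γ k θ) θ)
    (hμ : Function.Antiperiodic μ Real.pi) :
    Function.Antiperiodic (beta γ k) Real.pi := fun θ => by
  rw [beta_eq hp hM, beta_eq hp hM, ← intervalIntegral.integral_comp_add_right]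
  simp only [hμ _]
  rw [intervalIntegral.integral_neg]
  ring

/-- The derivative of the integral is `μ (θ + π) - μ θ = -2 μ θ`. -/
theorem hasDerivAt_beta (hp : IsDualPair (curveU γ k) (curveV γ k) ρ φ)
    (hM : ∀ θ, HasDerivAt (curveM γ) (μ θ • curveV γ k θ) θ)
    (hμ : Function.Antiperiodic μ Real.pi) (hμc : Continuous μ) (θ : ℝ) :
    HasDerivAt (beta γ k) (-μ θ) θ := by
  have hI : ∀ x, HasDerivAt (fun x => ∫ s in (0 : ℝ)..x, μ s) (μ x) x := fun x =>
    intervalIntegral.integral_hasDerivAt_right (hμc.intervalIntegrable _ _)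
      (hμc.stronglyMeasurableAtFilter _ _) hμc.continuousAt
  have heq : beta γ k = fun x => (1 / 2 : ℝ) *
      ((∫ s in (0 : ℝ)..(x + Real.pi), μ s) - ∫ s in (0 : ℝ)..x, μ s) := by
    funext x
    rw [beta_eq hp hM, intervalIntegral.integral_interval_sub_left
      (hμc.intervalIntegrable _ _) (hμc.intervalIntegrable _ _)]
  rw [heq]
  convert! (((hI (θ + Real.pi)).comp_add_const θ Real.pi).sub (hI θ)).const_mul (1 / 2 : ℝ) using 1
  rw [hμ θ]
  ring

theorem periodic_curveN (h : IsOval γ) (hp : IsDualPair (curveU γ k) (curveV γ k) ρ φ)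
    (hβ : Function.Antiperiodic (beta γ k) Real.pi) :
    Function.Periodic (curveN γ k) Real.pi := fun θ => by
  simp only [curveN, h.periodic_curveM θ, hβ θ, hp.antiperiodic_right θ, neg_smul_neg]

/-- In `N' = M' + β' v + β v'` the first two terms cancel, so `N'` is parallel to `u`. -/
theorem hasDerivAt_curveN (hp : IsDualPair (curveU γ k) (curveV γ k) ρ φ)
    (hM : ∀ θ, HasDerivAt (curveM γ) (μ θ • curveV γ k θ) θ)
    (hβ : ∀ θ, HasDerivAt (beta γ k) (-μ θ) θ) (θ : ℝ) :
    HasDerivAt (curveN γ k) (-(beta γ k θ * φ θ) • curveU γ k θ) θ := by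
  convert! (hM θ).add ((hβ θ).smul (hp.right θ)) using 1
  module

theorem hasDerivAt_curveEta (hp : IsDualPair (curveU γ k) (curveV γ k) ρ φ)
    (hN : ∀ θ, HasDerivAt (curveN γ k) (-(beta γ k θ * φ θ) • curveU γ k θ) θ) (d θ : ℝ) :
    HasDerivAt (curveEta γ k d) (-((beta γ k θ + d) * φ θ) • curveU γ k θ) θ := by
  convert! (hN θ).add ((hp.right θ).const_smul d) using 1
  module

theorem curveEta_add_pi (hp : IsDualPair (curveU γ k) (curveV γ k) ρ φ)
    (hN : Function.Periodic (curveN γ k) Real.pi) (d θ : ℝ) :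
    curveEta γ k d (θ + Real.pi) = curveN γ k θ - d • curveV γ k θ := by
  simp only [curveEta, hN θ, hp.antiperiodic_right θ, smul_neg, sub_eq_add_neg]

theorem curveEta_sub_add_pi (hp : IsDualPair (curveU γ k) (curveV γ k) ρ φ)
    (hN : Function.Periodic (curveN γ k) Real.pi) (d θ : ℝ) :
    curveEta γ k d θ - curveEta γ k d (θ + Real.pi) = (2 * d) • curveV γ k θ := by
  rw [curveEta_add_pi hp hN, curveEta]
  module

theorem curveM_curveEta (hp : IsDualPair (curveU γ k) (curveV γ k) ρ φ)
    (hN : Function.Periodic (curveN γ k) Real.pi) (d : ℝ) :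
    curveM (curveEta γ k d) = curveN γ k := by
  funext θ
  rw [curveM, curveEta_add_pi hp hN, curveEta]
  module

theorem curveN_mem_boundedRegion (h : IsOval γ)
    (hp : IsDualPair (curveU γ k) (curveV γ k) ρ φ)
    (hM : ∀ θ, HasDerivAt (curveM γ) (μ θ • curveV γ k θ) θ)
    (hNp : Function.Periodic (curveN γ k) Real.pi)
    (hN : ∀ θ, HasDerivAt (curveN γ k) (-(beta γ k θ * φ θ) • curveU γ k θ) θ) (t : ℝ) :
    curveN γ k t ∈ boundedRegion (Set.range (curveM γ)) := by
  refine involute_mem_boundedRegion (κ := ρ) (b := curveU γ k) hM h.periodic_curveM hp.right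
    (hp.continuous_right.smul hp.continuous_u).neg
    (fun θ => by rw [hp.bracket_right_deriv]; exact (hp.right_pos θ).ne')
    hp.antiperiodic_right hp.bracket_right_ne hNp (fun θ => ?_) (fun θ => (hp.left_pos θ).ne')
    (fun t θ => ?_) t
  · simp [curveN, bracket_smul_left]
  · convert! ((hN θ).const_sub (curveN γ k t)).bracket (hp.left θ) using 1
    simp [bracket_smul_left, bracket_smul_right]

theorem areaEvolute_curveEta_and_centerSymmetrySet_curveEta
    (hp : IsDualPair (curveU γ k) (curveV γ k) ρ φ)
    (hM : ∀ θ, HasDerivAt (curveM γ) (μ θ • curveV γ k θ) θ)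
    (hNp : Function.Periodic (curveN γ k) Real.pi)
    (hN : ∀ θ, HasDerivAt (curveN γ k) (-(beta γ k θ * φ θ) • curveU γ k θ) θ) {d : ℝ}
    (hd : ∀ θ, |beta γ k θ| < d) :
    areaEvolute (curveEta γ k d) = Set.range (curveN γ k) ∧
      centerSymmetrySet (curveEta γ k d) = Set.range (curveM γ) := by
  have hd0 : 0 < d := (abs_nonneg _).trans_lt (hd 0)
  have hder : ∀ θ, deriv (curveEta γ k d) θ = -((beta γ k θ + d) * φ θ) • curveU γ k θ :=
    fun θ => (hasDerivAt_curveEta hp hN d θ).deriv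
  -- The bound `|β| < d` makes the equidistant regular, with tangent direction `u`.
  have hρ : ∀ θ, -((beta γ k θ + d) * φ θ) ≠ 0 := fun θ =>
    neg_ne_zero.2 (mul_pos (by linarith [(abs_lt.1 (hd θ)).1]) (hp.right_pos θ)).ne'
  have hvne : ∀ θ, curveV γ k θ ≠ 0 := fun θ h0 => by
    have := hp.bracket_right_deriv θ
    rw [h0, bracket_zero_left] at this
    exact (hp.right_pos θ).ne this
  have hne : ∀ θ, curveEta γ k d θ ≠ curveEta γ k d (θ + Real.pi) := fun θ => by
    rw [← sub_ne_zero, curveEta_sub_add_pi hp hNp]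
    exact smul_ne_zero (by positivity) (hvne θ)
  have hper : Function.Periodic (curveEta γ k d) (2 * Real.pi) := fun θ => by
    simp only [curveEta]
    rw [two_mul, ← add_assoc, hNp, hNp, hp.antiperiodic_right, hp.antiperiodic_right, neg_neg]
  have hdiam := isDiameter_add_pi hder hp.antiperiodic_left hne
  have hopp : ∀ s t, IsDiameter (curveEta γ k d) s t →
      curveEta γ k d t = curveEta γ k d (s + Real.pi) := fun s t hst =>
    hst.eq_add_pi hper hder hρ hp.antiperiodic_left hp.bracket_left_ne
  refine ⟨by rw [areaEvolute_eq_range_curveM hdiam hopp, curveM_curveEta hp hNp], ?_⟩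
  refine centerSymmetrySet_eq_range (C := 2 * d) (by positivity) hdiam hopp hM hp.right
    (fun θ => by rw [hp.bracket_right_deriv]; exact (hp.right_pos θ).ne') fun X θ => ?_
  rw [curveEta_sub_add_pi hp hNp, bracket_smul_right, curveEta, curveN]
  simp only [bracket_sub_left, bracket_add_left, bracket_smul_left, bracket_self]
  ring

end Involute

/-! ### The exterior of `M`, and the center symmetry set of an oval. -/

/-- A ray that leaves an oval in the outer normal direction avoids `M`. -/
theorem IsOval.not_isBounded_connectedComponentIn {γ : ℝ → Plane} (h : IsOval γ) {t : ℝ}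
    (ht : γ t ∉ Set.range (curveM γ)) :
    ¬Bornology.IsBounded (connectedComponentIn (Set.range (curveM γ))ᶜ (γ t)) := by
  set R : Set Plane := (fun s : ℝ => γ t + s • nTheta t) '' Set.Ici 0 with hR
  have hpre : IsPreconnected R := isPreconnected_Ici.image _ (by fun_prop)
  have hmem : γ t ∈ R := ⟨0, Set.self_mem_Ici, by simp⟩
  have hsub : R ⊆ (Set.range (curveM γ))ᶜ := by
    rintro _ ⟨s, hs, rfl⟩ ⟨θ, hθ⟩
    rcases eq_or_lt_of_le (Set.mem_Ici.1 hs) with h0 | h0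
    · exact ht ⟨θ, by simpa [← h0] using hθ⟩
    -- A point of `M` averages two points of the oval, so it is not above the tangent at `t`; the
    -- ray beyond its origin is.
    have h1 := h.bracket_sub_eTheta_nonneg t θ
    have h2 := h.bracket_sub_eTheta_nonneg t (θ + Real.pi)
    have h3 : bracket (curveM γ θ) (eTheta t) = bracket (γ t) (eTheta t) + s := by
      rw [hθ]
      simp only [bracket_add_left, bracket_smul_left, bracket_nTheta_eTheta, mul_one]
    simp only [curveM, bracket_smul_left, bracket_add_left] at h3
    rw [bracket_sub_left] at h1 h2
    linarith
  intro hb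
  obtain ⟨C, hC⟩ := (hb.subset (hpre.subset_connectedComponentIn hmem hsub)).exists_norm_le
  have hn : nTheta t ≠ 0 := fun h0 => by
    have := bracket_nTheta_eTheta t
    simp [h0] at this
  have hpos : 0 < ‖nTheta t‖ := norm_pos_iff.2 hn
  have hC0 : 0 ≤ C := (norm_nonneg _).trans (hC _ hmem)
  -- Far enough along the ray to have norm at least `C + 1`.
  set s := (C + ‖γ t‖ + 1) / ‖nTheta t‖ with hs
  have hs0 : 0 ≤ s := by positivity
  have h1 := hC _ ⟨s, hs0, rfl⟩
  have h2 : ‖s • nTheta t‖ = C + ‖γ t‖ + 1 := by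
    rw [norm_smul, Real.norm_of_nonneg hs0, hs, div_mul_cancel₀ _ hpos.ne']
  have h3 : ‖s • nTheta t‖ ≤ ‖γ t + s • nTheta t‖ + ‖γ t‖ := by
    have := norm_sub_le (γ t + s • nTheta t) (γ t)
    rwa [add_sub_cancel_left] at this
  simp only at h1
  linarith

/-- A path from the oval to `p` avoiding `M` would put `p` in the component of a point of the oval,
which is unbounded. -/
theorem IsOval.boundedRegion_subset_compl_exteriorFrom {γ : ℝ → Plane} (h : IsOval γ) :
    boundedRegion (Set.range (curveM γ)) ⊆ (exteriorFrom γ (curveM γ))ᶜ := by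
  rintro p hp ⟨t, ht⟩
  have hb := hp ht.target_mem
  obtain ⟨f, hf⟩ := ht
  have hγ : γ t ∈ connectedComponentIn (Set.range (curveM γ))ᶜ p := by
    refine (isPreconnected_range f.continuous).subset_connectedComponentIn ⟨1, f.target⟩ ?_
      ⟨0, f.source⟩
    rintro _ ⟨x, rfl⟩
    exact hf x
  rw [connectedComponentIn_eq hγ] at hb
  exact h.not_isBounded_connectedComponentIn (by simpa using hf 0) hb

theorem IsOval.areaEvolute_subset_boundedRegion {η : ℝ → Plane} (h : IsOval η) :
    areaEvolute η ⊆ boundedRegion (centerSymmetrySet η) := by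
  obtain ⟨ρ, φ, μ, hp, hρd, hμd, hμ, hM⟩ := h.exists_isDualPair one_pos
  obtain ⟨r, hr, -, -, hd⟩ := h.exists_radius
  have hu : ∀ θ, η θ - η (θ + Real.pi) = (2 : ℝ) • curveU η 1 θ := fun θ => by
    rw [curveU]; module
  have hη : ∀ θ, η θ = curveM η θ + curveU η 1 θ := fun θ => by
    rw [curveU, curveM]; module
  have hdiam := isDiameter_add_pi (fun θ => (hd θ).deriv) antiperiodic_eTheta fun θ h0 => by
    have := h.width_pos θ
    simp [h0] at this
  have hopp : ∀ s t, IsDiameter η s t → η t = η (s + Real.pi) := fun s t hst =>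
    hst.eq_add_pi h.periodic (fun θ => (hd θ).deriv) (fun θ => (hr θ).ne') antiperiodic_eTheta
      fun s t => bracket_eTheta_ne_zero
  set α : ℝ → ℝ := fun θ => μ θ / ρ θ with hα
  have hαd : Differentiable ℝ α := hμd.div hρd fun θ => (hp.left_pos θ).ne'
  have hραm : ∀ θ, α θ * ρ θ = μ θ := fun θ => div_mul_cancel₀ _ (hp.left_pos θ).ne'
  have hρp : ∀ θ, ρ (θ + Real.pi) = ρ θ := by
    intro θ
    have h1 := (hp.left (θ + Real.pi)).comp_add_const θ Real.pi
    rw [funext hp.antiperiodic_left] at h1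
    have h2 := h1.unique (hp.left θ).fun_neg
    have h3 := congrArg (bracket (curveU η 1 θ)) h2
    rw [hp.antiperiodic_right, smul_neg, bracket_neg_right, bracket_neg_right,
      hp.bracket_left_deriv, bracket_smul_right, hp.bracket_eq_one] at h3
    linarith
  -- The envelope of the diameters: it lies on the lines through `M θ` along `u θ`, and since `M' =
  -- α u'` its derivative is `-α' u`.
  set K : ℝ → Plane := fun θ => curveM η θ - α θ • curveU η 1 θ with hKdef
  have hK : ∀ θ, HasDerivAt K (-deriv α θ • curveU η 1 θ) θ := by
    intro θ
    convert! (hM θ).sub ((hαd θ).hasDerivAt.smul (hp.left θ)) using 1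
    rw [smul_smul, hραm]
    module
  have hKp : Function.Periodic K Real.pi := fun θ => by
    simp only [hKdef, hα, h.periodic_curveM θ, hμ θ, hρp, hp.antiperiodic_left θ, neg_div,
      neg_smul_neg]
  have haa : ∀ θ, bracket (curveU η 1 θ) (ρ θ • curveV η 1 θ) ≠ 0 := fun θ => by
    rw [hp.bracket_left_deriv]; exact (hp.left_pos θ).ne'
  rw [areaEvolute_eq_range_curveM hdiam hopp,
    centerSymmetrySet_eq_range (C := 2) two_ne_zero hdiam hopp hK hp.left haa fun X θ => ?_]
  · rintro _ ⟨t, rfl⟩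
    -- The roles of `u` and `v` are exchanged; `M'` is parallel to `v`, so differentiating `[M t - M
    -- x, v x]` leaves only the `v'` term.
    refine involute_mem_boundedRegion (κ := fun θ => -φ θ) (b := curveV η 1) hK hKp hp.left
      (hp.continuous_left.smul hp.continuous_v) haa hp.antiperiodic_left hp.bracket_left_ne
      h.periodic_curveM (fun θ => ?_) (fun θ => neg_ne_zero.2 (hp.right_pos θ).ne')
      (fun t θ => ?_) t
    · simp [hKdef, bracket_smul_left]
    · convert! ((hM θ).const_sub (curveM η t)).bracket (hp.right θ) using 1
      simp [bracket_neg_left, bracket_smul_left, bracket_smul_right, bracket_neg_right]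
  · rw [hu, bracket_smul_right, hη]
    simp only [hKdef, bracket_sub_left, bracket_add_left, bracket_smul_left, bracket_self]
    ring

theorem mainTheorem2 :
    (∀ γ : ℝ → Plane, IsOval γ → ∀ k : ℝ, 0 < k →
      (∀ θ : ℝ, deriv (curveM γ) θ = alpha γ k θ • deriv (curveU γ k) θ) ∧
      Set.range (curveN γ k) ⊆ (exteriorFrom γ (curveM γ))ᶜ ∧
      (∀ d θ : ℝ, curveEta γ k d θ - curveEta γ k d (θ + Real.pi) = (2 * d) • curveV γ k θ) ∧
      (∀ d : ℝ, (∀ θ : ℝ, |beta γ k θ| < d) →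
        areaEvolute (curveEta γ k d) = Set.range (curveN γ k) ∧
        centerSymmetrySet (curveEta γ k d) = Set.range (curveM γ))) ∧
    (∀ η : ℝ → Plane, IsOval η → areaEvolute η ⊆ boundedRegion (centerSymmetrySet η)) := by
  refine ⟨fun γ h k hk => ?_, fun η h => h.areaEvolute_subset_boundedRegion⟩
  obtain ⟨ρ, φ, μ, hp, -, hμd, hμ, hM⟩ := h.exists_isDualPair hk
  have hNp := periodic_curveN h hp (antiperiodic_beta hp hM hμ)
  have hN := hasDerivAt_curveN hp hM (hasDerivAt_beta hp hM hμ hμd.continuous)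
  refine ⟨fun θ => ?_, ?_, curveEta_sub_add_pi hp hNp, fun d hd =>
    areaEvolute_curveEta_and_centerSymmetrySet_curveEta hp hM hNp hN hd⟩
  · rw [(hM θ).deriv, (hp.left θ).deriv, alpha_eq hp hM, smul_smul,
      div_mul_cancel₀ _ (hp.left_pos θ).ne']
  · rintro _ ⟨t, rfl⟩
    exact h.boundedRegion_subset_compl_exteriorFrom
      (curveN_mem_boundedRegion h hp hM hNp hN t)
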